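/- Let $\gamma,\kappa\ge 2$ be integers with $\gamma\kappa>\gamma+\kappa$ (i.e. $(\gamma,\kappa)\ne(2,2)$), let $m\ge 0$ be the memory, $Z\ge 1$ the lifting degree and $N\ge 1$ the coupling length. A design is a pair $(\mathbf P,\mathbf L)$ of a partition matrix $\mathbf P\in\{0,\dots,m\}^{\gamma\times\kappa}$ and a lifting matrix $\mathbf L\in\{0,\dots,Z-1\}^{\gamma\times\kappa}$. It determines a QC-SC-LDPC parity-check matrix over the all-one $\gamma\times\kappa$ base matrix: for $0\le\ell\le m$ let $\mathbf H_\ell$ be the $0/1$ matrix with $\mathbf H_\ell(i,j)=1$ iff $\mathbf P(i,j)=\ell$; stack $\mathbf H_0,\dots,\mathbf H_m$ vertically into a replica, place $N$ copies of the replica side by side, the $t$-th one ($0\le t<N$) shifted down by $t$ block rows and all other blocks zero; then replace every $1$ coming from the base edge $(i,j)$ by $\sigma^{\mathbf L(i,j)}$, where $\sigma$ is the $Z\times Z$ one-step left cyclic shift of the identity, and every $0$ by the $Z\times Z$ zero matrix. A 4-cycle candidate consists of two distinct rows $i_1\neq i_2$ and two distinct columns $j_1\ne j_2$ of the base matrix;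 it is active if the Tanner graph of the parity-check matrix has a 4-cycle whose check nodes lie over $i_1,i_2$ and whose variable nodes lie over $j_1,j_2$. A design is 4-cycle-free if no 4-cycle candidate is active. Two designs are equivalent if one is obtained from the other by a permutation of the $\gamma$ rows and a permutation of the $\kappa$ columns, the same permutations being applied to $\mathbf P$ and to $\mathbf L$. Let $\#_N$ be the number of equivalence classes of 4-cycle-free designs. Put $\Delta=(2\gamma-3)(2\kappa-3)$, $$I=\frac{(\Delta-1)^{\Delta-1}}{\Delta^{\Delta}},\qquad II=\frac{27}{256(\gamma\kappa-\gamma-\kappa)} .$$ If $$\frac{2m^2+4m+3}{3(m+1)^3Z}\le\max\{I,II\},$$ then $$\#_N\ \ge\ \begin{cases}\dfrac{[Z(m+1)]^{\gamma\kappa}}{\gamma!\,\kappa!}\left(1-\dfrac{2}{\Delta}\right)^{\binom{\gamma}{2}\binom{\kappa}{2}},& \text{if } I>II,\\[3mm] \dfrac{[Z(m+1)]^{\gamma\kappa}}{\gamma!\,\kappa!}\left(1-\dfrac{\gamma\kappa-\gamma-\kappa+1}{4(\gamma\kappa-\gamma-\kappa)}\right)^{\gamma\kappa},& \text{if } I\le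 II.\end{cases}$$ -/

import Mathlib

open scoped Nat

namespace QCSC

/-- A design for a Type-I QC-SC-LDPC code built on the all-one `γ × κ` base matrix, with memory `m`
and lifting degree `Z`: every base edge `(i, j)` carries the pair `(P(i,j), L(i,j))` formed by an
entry of the partition matrix and an entry of the lifting matrix. -/
abbrev Design (γ κ m Z : ℕ) : Type := Matrix (Fin γ) (Fin κ) (Fin (m + 1) × ZMod Z)

/-- The partition (edge-spreading) matrix of a design. -/
def Design.partition {γ κ m Z : ℕ} (D : Design γ κ m Z) : Matrix (Fin γ) (Fin κ) (Fin (m + 1)) :=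
  fun i j => (D i j).1

/-- The lifting matrix of a design. -/
def Design.lifting {γ κ m Z : ℕ} (D : Design γ κ m Z) : Matrix (Fin γ) (Fin κ) (ZMod Z) :=
  fun i j => (D i j).2

/-- The component matrix `H_ℓ`: its entry at `(i, j)` is `1` exactly when the base edge `(i, j)` is
assigned to the component `ℓ`. It vanishes for `ℓ > m`. -/
def Design.component {γ κ m Z : ℕ} (D : Design γ κ m Z) (l : ℕ) :
    Matrix (Fin γ) (Fin κ) (ZMod 2) :=
  fun i j => if (D.partition i j : ℕ) = l then 1 else 0

/-- The coupled protograph matrix with coupling length `N`: the `t`-th replica, that is the stack of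
`H_0, …, H_m`, occupies the block column `t` and starts at the block row `t`. -/
def Design.coupled {γ κ m Z : ℕ} (D : Design γ κ m Z) (N : ℕ) :
    Matrix (Fin (N + m) × Fin γ) (Fin N × Fin κ) (ZMod 2) :=
  fun r c => if (c.1 : ℕ) ≤ (r.1 : ℕ) then D.component ((r.1 : ℕ) - (c.1 : ℕ)) r.2 c.2 else 0

/-- The `Z × Z` circulant permutation matrix obtained from the identity by a one-step left cyclic
shift: row `a` has its `1` in column `a - 1`. -/
def circulant (Z : ℕ) : Matrix (ZMod Z) (ZMod Z) (ZMod 2) :=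
  fun a b => if b = a - 1 then 1 else 0

/-- The parity-check matrix: each `1` of the coupled protograph matrix that comes from the base edge
`(i, j)` is replaced by the power `L(i,j) ∈ {0, …, Z - 1}` of the circulant, each `0` by the zero
matrix. -/
def Design.parityCheck {γ κ m Z : ℕ} [NeZero Z] (D : Design γ κ m Z) (N : ℕ) :
    Matrix ((Fin (N + m) × Fin γ) × ZMod Z) ((Fin N × Fin κ) × ZMod Z) (ZMod 2) :=
  fun r c => D.coupled N r.1 c.1 * (circulant Z ^ (D.lifting r.1.2 c.1.2).val) r.2 c.2

/-- The Tanner graph of a binary matrix: the check nodes are the rows, the variable nodes are the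
columns, and the edges are the nonzero entries. -/
def tannerGraph {R C : Type*} (M : Matrix R C (ZMod 2)) : SimpleGraph (R ⊕ C) where
  Adj
    | .inl r, .inr c => M r c = 1
    | .inr c, .inl r => M r c = 1
    | _, _ => False
  symm := ⟨by rintro (r | c) (r' | c') h <;> exact h⟩
  loopless := ⟨by rintro (r | c) h <;> exact h⟩

/-- A 4-cycle candidate `(j₁, i₁, j₂, i₂)` of the fully connected base graph. -/
structure FourCycle (γ κ : ℕ) where
  j₁ : Fin κ
  i₁ : Fin γ
  j₂ : Fin κ
  i₂ : Fin γ
  rows_ne : i₁ ≠ i₂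
  cols_ne : j₁ ≠ j₂

/-- A 4-cycle candidate is active for a design (and coupling length `N`) if, after edge spreading
and lifting, the Tanner graph contains a 4-cycle lying over it: check nodes `r₁, r₂` over the base
rows `i₁, i₂` and variable nodes `c₁, c₂` over the base columns `j₁, j₂`, with
`c₁ ~ r₁ ~ c₂ ~ r₂ ~ c₁`. -/
def FourCycle.IsActive {γ κ m Z : ℕ} [NeZero Z] (c : FourCycle γ κ) (D : Design γ κ m Z) (N : ℕ) :
    Prop :=
  ∃ (r₁ r₂ : (Fin (N + m) × Fin γ) × ZMod Z) (c₁ c₂ : (Fin N × Fin κ) × ZMod Z),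
    r₁.1.2 = c.i₁ ∧ r₂.1.2 = c.i₂ ∧ c₁.1.2 = c.j₁ ∧ c₂.1.2 = c.j₂ ∧
    (tannerGraph (D.parityCheck N)).Adj (.inr c₁) (.inl r₁) ∧
    (tannerGraph (D.parityCheck N)).Adj (.inl r₁) (.inr c₂) ∧
    (tannerGraph (D.parityCheck N)).Adj (.inr c₂) (.inl r₂) ∧
    (tannerGraph (D.parityCheck N)).Adj (.inl r₂) (.inr c₁)

/-- The feasible designs: no 4-cycle candidate is active. -/
def fourCycleFree (γ κ m Z N : ℕ) [NeZero Z] : Set (Design γ κ m Z) :=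
  {D | ∀ c : FourCycle γ κ, ¬ c.IsActive D N}

/-- Two matrices are equivalent if one arises from the other by permuting rows and columns: row `i`
of `M` is row `ν i` of `M'`, and column `j` of `M` is column `ρ j` of `M'`. Applied to designs, the
same permutations act on the partition matrix and on the lifting matrix. -/
def matrixEquiv (γ κ : ℕ) (α : Type*) : Setoid (Matrix (Fin γ) (Fin κ) α) where
  r M M' := ∃ (ν : Equiv.Perm (Fin γ)) (ρ : Equiv.Perm (Fin κ)), ∀ i j, M i j = M' (ν i) (ρ j)
  iseqv :=
    { refl := fun _ => ⟨1, 1, fun _ _ => rfl⟩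
      symm := by
        rintro M M' ⟨ν, ρ, h⟩
        exact ⟨ν.symm, ρ.symm, fun i j => by simp [h]⟩
      trans := by
        rintro M M' M'' ⟨ν, ρ, h⟩ ⟨ν', ρ', h'⟩
        exact ⟨ν.trans ν', ρ.trans ρ', fun i j => by simp [h, h']⟩ }

/-- The number of pairwise non-equivalent 4-cycle-free designs: the number of equivalence classes
of the set of feasible designs. -/
noncomputable def numNonequivalent (γ κ m Z N : ℕ) [NeZero Z] : ℕ :=
  Nat.card (Quotient ((matrixEquiv γ κ (Fin (m + 1) × ZMod Z)).comap
    (Subtype.val : fourCycleFree γ κ m Z N → Design γ κ m Z)))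

/-- `Δ = (2γ - 3)(2κ - 3)`. The truncated subtractions are exact, as only `γ, κ ≥ 2` occur. -/
def Delta (γ κ : ℕ) : ℕ := (2 * γ - 3) * (2 * κ - 3)

/-- `I = (Δ - 1)^(Δ - 1) / Δ^Δ`. -/
noncomputable def boundI (γ κ : ℕ) : ℝ :=
  ((Delta γ κ : ℝ) - 1) ^ (Delta γ κ - 1) / (Delta γ κ : ℝ) ^ Delta γ κ

/-- `II = 27 / (256 (γκ - γ - κ))`. -/
noncomputable def boundII (γ κ : ℕ) : ℝ :=
  27 / (256 * ((γ : ℝ) * κ - γ - κ))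

end QCSC

/-!
Give every base edge an independent uniform label in `{0, …, m} × ℤ/Z`. An active 4-cycle candidate
forces its four labels to satisfy an additive relation in each component, and the probability of
this relation is a product of normalized additive energies. The relation is symmetric under swapping
the two rows or the two columns, so the bad events are indexed by rectangles, a pair of rows with a
pair of columns, and events with disjoint sets of base edges are independent.

A rectangle shares a base edge with `Δ - 1` others, and a base edge lies in
`(γ - 1)(κ - 1) = γκ - γ - κ + 1` rectangles, which form a clique of the dependency graph. The
Lovász local lemma and the clique local lemma of Kolipaka, Szegedy and Xu bound the number of
labelings without bad events from below. The hypotheses `I` and `II` are the maxima over `x` of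
`x(1 - x)^(Δ - 1)` and of `x(1 - (γκ - γ - κ)x)³`, attained at `x = 1/Δ` and at
`x = 1/(4(γκ - γ - κ))`. Finally an equivalence class has at most `γ! κ!` elements.
-/

namespace LocalLemma

open Finset MeasureTheory

theorem prod_mul_le_of_mul_insert_le {ι R : Type*} [DecidableEq ι] [CommSemiring R]
    [PartialOrder R] [IsOrderedRing R] {g : Finset ι → R} {y : ι → R} {T : Finset ι}
    (hy : ∀ i ∈ T, 0 ≤ y i) (hg : ∀ i ∈ T, ∀ U, y i * g (insert i U) ≤ g U) :
    (∏ i ∈ T, y i) * g T ≤ g ∅ := by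
  induction T using Finset.induction_on with
  | empty => simp
  | insert i T hi ih =>
    have hyT : ∀ j ∈ T, 0 ≤ y j := fun j hj => hy j (mem_insert_of_mem hj)
    calc (∏ j ∈ insert i T, y j) * g (insert i T)
        = (∏ j ∈ T, y j) * (y i * g (insert i T)) := by rw [prod_insert hi]; ring
      _ ≤ (∏ j ∈ T, y j) * g T :=
        mul_le_mul_of_nonneg_left (hg i (mem_insert_self i T) T) (prod_nonneg hyT)
      _ ≤ g ∅ := ih hyT fun j hj => hg j (mem_insert_of_mem hj)

variable {Ω β : Type*}

/-- The set of outcomes at which none of the events `A b` with `b ∈ S` occurs; the local lemmas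
bound its measure from below. -/
def avoid (A : β → Set Ω) (S : Finset β) : Set Ω := {ω | ∀ b ∈ S, ω ∉ A b}

theorem avoid_empty (A : β → Set Ω) : avoid A ∅ = Set.univ := by
  simp [avoid]

theorem avoid_anti (A : β → Set Ω) {R S : Finset β} (h : R ⊆ S) : avoid A S ⊆ avoid A R :=
  fun _ hω b hb => hω b (h hb)

variable [MeasurableSpace Ω] (μ : Measure Ω) [IsFiniteMeasure μ] {A : β → Set Ω}

theorem measureReal_avoid_le_add_sum {R S C : Finset β} (h : ∀ b ∈ S, b ∈ R ∨ b ∈ C) :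
    μ.real (avoid A R) ≤ μ.real (avoid A S) + ∑ b ∈ C, μ.real (A b ∩ avoid A R) := by
  have hcover : avoid A R ⊆ avoid A S ∪ ⋃ b ∈ C, A b ∩ avoid A R := by
    intro ω hω
    by_cases hC : ∃ b ∈ C, ω ∈ A b
    · obtain ⟨b, hb, hωb⟩ := hC
      exact Or.inr (Set.mem_biUnion hb ⟨hωb, hω⟩)
    · push Not at hC
      exact Or.inl fun b hb => (h b hb).elim (hω b) (hC b)
  calc μ.real (avoid A R) ≤ μ.real (avoid A S ∪ ⋃ b ∈ C, A b ∩ avoid A R) := measureReal_mono hcover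
    _ ≤ μ.real (avoid A S) + μ.real (⋃ b ∈ C, A b ∩ avoid A R) := measureReal_union_le _ _
    _ ≤ _ := by gcongr; exact measureReal_biUnion_finset_le _ _

theorem measureReal_inter_avoid_le {b : β} {w y : ℝ} {R S : Finset β} (hRS : R ⊆ S) (hw : 0 ≤ w)
    (hb : μ.real (A b ∩ avoid A R) ≤ w * y * μ.real (avoid A R))
    (hy : y * μ.real (avoid A R) ≤ μ.real (avoid A S)) :
    μ.real (A b ∩ avoid A S) ≤ w * μ.real (avoid A S) :=
  calc μ.real (A b ∩ avoid A S) ≤ μ.real (A b ∩ avoid A R) :=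
        measureReal_mono (Set.inter_subset_inter_right _ (avoid_anti A hRS))
    _ ≤ w * (y * μ.real (avoid A R)) := by rwa [← mul_assoc]
    _ ≤ w * μ.real (avoid A S) := mul_le_mul_of_nonneg_left hy hw

section Lovasz

variable {Γ : β → Finset β} {x : β → ℝ}

theorem one_sub_mul_measureReal_avoid_erase_le [DecidableEq β] (hx0 : ∀ b, 0 ≤ x b)
    (hx1 : ∀ b, x b ≤ 1)
    (hA : ∀ b S, b ∉ S → Disjoint S (Γ b) → μ.real (A b ∩ avoid A S) ≤
      x b * (∏ c ∈ Γ b, (1 - x c)) * μ.real (avoid A S)) (S : Finset β) (b : β) :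
    (1 - x b) * μ.real (avoid A (S.erase b)) ≤ μ.real (avoid A S) := by
  induction S using Finset.strongInduction generalizing b with
  | H S ih =>
  by_cases hb : b ∈ S
  · have hremove : (∏ c ∈ Γ b, (1 - x c)) * μ.real (avoid A (S.erase b \ Γ b)) ≤
        μ.real (avoid A (S.erase b)) := by
      have h := prod_mul_le_of_mul_insert_le (g := fun U => μ.real (avoid A (S.erase b \ U)))
        (T := Γ b) (fun c _ => sub_nonneg.2 (hx1 c)) fun c _ U => by
          rw [sdiff_insert]
          exact ih _ (sdiff_subset.trans_ssubset (erase_ssubset hb)) c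
      simpa only [sdiff_empty] using h
    have hhit : μ.real (A b ∩ avoid A (S.erase b)) ≤ x b * μ.real (avoid A (S.erase b)) :=
      measureReal_inter_avoid_le μ sdiff_subset (hx0 b)
        (hA b _ (by simp) sdiff_disjoint) hremove
    have hsplit := measureReal_avoid_le_add_sum μ (A := A) (R := S.erase b) (S := S) (C := {b})
      fun c hc => by simp [hc, em']
    rw [sum_singleton] at hsplit
    linarith
  · rw [erase_eq_of_notMem hb]
    exact mul_le_of_le_one_left measureReal_nonneg (sub_le_self 1 (hx0 b))

/-- The **Lovász local lemma**. The dependency hypothesis is the one-sided (lopsided) one: it only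
bounds the occurrence of `A b` from above while events outside `Γ b` are being avoided. -/
theorem prod_one_sub_mul_le_measureReal_avoid (hx0 : ∀ b, 0 ≤ x b) (hx1 : ∀ b, x b ≤ 1)
    (hA : ∀ b S, b ∉ S → Disjoint S (Γ b) → μ.real (A b ∩ avoid A S) ≤
      x b * (∏ c ∈ Γ b, (1 - x c)) * μ.real (avoid A S)) (S : Finset β) :
    (∏ b ∈ S, (1 - x b)) * μ.real Set.univ ≤ μ.real (avoid A S) := by
  classical
  have h := prod_mul_le_of_mul_insert_le (g := fun U => μ.real (avoid A (S \ U))) (T := S)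
    (fun c _ => sub_nonneg.2 (hx1 c)) fun c _ U => by
      rw [sdiff_insert]
      exact one_sub_mul_measureReal_avoid_erase_le μ hx0 hx1 hA _ c
  simpa only [sdiff_self, bot_eq_empty, avoid_empty, sdiff_empty] using h

end Lovasz

section Clique

variable {ι : Type*} [DecidableEq ι] [Fintype β] [DecidableEq β] {supp : β → Finset ι}
  {x : β → ι → ℝ}

theorem one_sub_sum_mul_measureReal_avoid_filter_le (hx0 : ∀ b v, 0 ≤ x b v)
    (hx1 : ∀ v, ∑ b with v ∈ supp b, x b v ≤ 1)
    (hA : ∀ b, ∀ v ∈ supp b, ∀ S, (∀ c ∈ S, Disjoint (supp b) (supp c)) →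
      μ.real (A b ∩ avoid A S) ≤
        x b v * (∏ u ∈ (supp b).erase v, (1 - ∑ c with u ∈ supp c ∧ c ≠ b, x c u)) *
          μ.real (avoid A S)) (S : Finset β) (v : ι) :
    (1 - ∑ b ∈ S with v ∈ supp b, x b v) * μ.real (avoid A {b ∈ S | v ∉ supp b}) ≤
      μ.real (avoid A S) := by
  induction S using Finset.strongInduction generalizing v with
  | H S ih =>
  set S' := {b ∈ S | v ∉ supp b}
  have hhit : ∀ b ∈ S.filter (v ∈ supp ·),
      μ.real (A b ∩ avoid A S') ≤ x b v * μ.real (avoid A S') := by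
    intro b hb
    obtain ⟨hbS, hvb⟩ := mem_filter.1 hb
    have hbS' : b ∉ S' := fun h => (mem_filter.1 h).2 hvb
    have hS' : S' ⊂ S := (filter_subset _ _).ssubset_of_mem_notMem hbS hbS'
    have hremove : (∏ u ∈ (supp b).erase v, (1 - ∑ c with u ∈ supp c ∧ c ≠ b, x c u)) *
        μ.real (avoid A {c ∈ S' | Disjoint ((supp b).erase v) (supp c)}) ≤ μ.real (avoid A S') := by
      have h := prod_mul_le_of_mul_insert_le
        (g := fun E => μ.real (avoid A {c ∈ S' | Disjoint E (supp c)}))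
        (y := fun u => 1 - ∑ c with u ∈ supp c ∧ c ≠ b, x c u) (T := (supp b).erase v) ?_ ?_
      · simpa only [disjoint_empty_left, filter_true] using h
      · refine fun u _ => sub_nonneg.2 ((sum_le_sum_of_subset_of_nonneg ?_ ?_).trans (hx1 u))
        · exact monotone_filter_right _ fun c _ hc => hc.1
        · exact fun c _ _ => hx0 c u
      · intro u _ E
        set Q := {c ∈ S' | Disjoint E (supp c)}
        have hQ : {c ∈ S' | Disjoint (insert u E) (supp c)} = {c ∈ Q | u ∉ supp c} := by
          simp only [Q, filter_filter, disjoint_insert_left, and_comm]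
        rw [hQ]
        refine le_trans (mul_le_mul_of_nonneg_right (sub_le_sub_left ?_ 1) measureReal_nonneg)
          (ih Q ((filter_subset _ _).trans_ssubset hS') u)
        refine sum_le_sum_of_subset_of_nonneg (fun c hc => ?_) fun c _ _ => hx0 c u
        obtain ⟨hcQ, huc⟩ := mem_filter.1 hc
        exact mem_filter.2 ⟨mem_univ c, huc, fun h => hbS' (h ▸ (mem_filter.1 hcQ).1)⟩
    refine measureReal_inter_avoid_le μ (filter_subset _ _) (hx0 b v) (hA b v hvb _ ?_) hremove
    intro c hc
    obtain ⟨hcS', hdisj⟩ := mem_filter.1 hc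
    rw [← insert_erase hvb, disjoint_insert_left]
    exact ⟨(mem_filter.1 hcS').2, hdisj⟩
  have hsplit := measureReal_avoid_le_add_sum μ (A := A) (R := S') (S := S)
    (C := S.filter (v ∈ supp ·)) fun c hc => by simp [S', hc, em']
  have hsum := sum_le_sum hhit
  rw [← sum_mul] at hsum
  linarith

/-- The **clique local lemma** of Kolipaka, Szegedy and Xu: the events whose support contains `v`
form a clique of the dependency graph, and `x b v` is the weight of `b` in that clique. -/
theorem prod_one_sub_sum_mul_le_measureReal_avoid [Fintype ι] (hsupp : ∀ b, (supp b).Nonempty)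
    (hx0 : ∀ b v, 0 ≤ x b v) (hx1 : ∀ v, ∑ b with v ∈ supp b, x b v ≤ 1)
    (hA : ∀ b, ∀ v ∈ supp b, ∀ S, (∀ c ∈ S, Disjoint (supp b) (supp c)) →
      μ.real (A b ∩ avoid A S) ≤
        x b v * (∏ u ∈ (supp b).erase v, (1 - ∑ c with u ∈ supp c ∧ c ≠ b, x c u)) *
          μ.real (avoid A S)) :
    (∏ v, (1 - ∑ b with v ∈ supp b, x b v)) * μ.real Set.univ ≤ μ.real (avoid A univ) := by
  have h := prod_mul_le_of_mul_insert_le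
    (g := fun E => μ.real (avoid A {b | Disjoint E (supp b)})) (T := univ)
    (fun v _ => sub_nonneg.2 (hx1 v)) fun v _ E => ?_
  · have huniv : ({b | Disjoint univ (supp b)} : Finset β) = ∅ :=
      filter_false_of_mem fun b _ hb => (hsupp b).ne_empty
        (eq_empty_of_forall_notMem fun v hv => disjoint_left.1 hb (mem_univ v) hv)
    simpa only [huniv, avoid_empty, disjoint_empty_left, filter_true] using h
  · set Q : Finset β := {b | Disjoint E (supp b)}
    have hQ : ({b | Disjoint (insert v E) (supp b)} : Finset β) = {b ∈ Q | v ∉ supp b} := by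
      simp only [Q, filter_filter, disjoint_insert_left, and_comm]
    rw [hQ]
    refine le_trans (mul_le_mul_of_nonneg_right (sub_le_sub_left ?_ 1) measureReal_nonneg)
      (one_sub_sum_mul_measureReal_avoid_filter_le μ hx0 hx1 hA Q v)
    exact sum_le_sum_of_subset_of_nonneg (filter_subset_filter _ (subset_univ Q))
      fun c _ _ => hx0 c v

end Clique

section Product

variable {ι β : Type*} {V : ι → Type*}

theorem ncard_preimage_of_involutive {α : Type*} {f : α → α} (hf : f.Involutive) (s : Set α) :
    (f ⁻¹' s).ncard = s.ncard :=
  Set.ncard_preimage_of_injective_subset_range hf.injective fun a _ => hf.surjective a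

theorem ncard_inter_mul_card_of_dependsOn {s : Set ι} {A B : Set (Π i, V i)}
    (hA : DependsOn (· ∈ A) s) (hB : DependsOn (· ∈ B) sᶜ) :
    (A ∩ B).ncard * Nat.card (Π i, V i) = A.ncard * B.ncard := by
  classical
  -- Exchanging the coordinates outside `s` between two copies of the product turns `A ∩ B` for one
  -- copy into `A` for the first and `B` for the second.
  let swap : (Π i, V i) × (Π i, V i) → (Π i, V i) × (Π i, V i) :=
    fun z => (s.piecewise z.1 z.2, s.piecewise z.2 z.1)
  have hswap : swap.Involutive := by
    rintro ⟨f, g⟩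
    ext i <;> by_cases hi : i ∈ s <;> simp [swap, hi]
  have hpreimage : swap ⁻¹' (A ×ˢ B) = (A ∩ B) ×ˢ Set.univ := by
    ext ⟨f, g⟩
    have hfA : (s.piecewise f g ∈ A) = (f ∈ A) := hA fun i hi => s.piecewise_eq_of_mem f g hi
    have hfB : (s.piecewise g f ∈ B) = (f ∈ B) := hB fun i hi => s.piecewise_eq_of_notMem g f hi
    simp [swap, hfA, hfB]
  rw [← Set.ncard_univ, ← Set.ncard_prod, ← Set.ncard_prod, ← hpreimage,
    ncard_preimage_of_involutive hswap]

theorem ncard_comp_mem_mul_card {τ W : Type*} {g : τ → ι} (hg : g.Injective) (T : Set (τ → W)) :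
    {f : ι → W | f ∘ g ∈ T}.ncard * Nat.card (τ → W) = T.ncard * Nat.card (ι → W) := by
  let swap : (τ → W) × (ι → W) → (τ → W) × (ι → W) :=
    fun z => (z.2 ∘ g, Function.extend g z.1 z.2)
  have hswap : swap.Involutive := by
    rintro ⟨h, f⟩
    refine Prod.ext (Function.extend_comp hg h f) (funext fun i => ?_)
    by_cases hi : ∃ a, g a = i
    · obtain ⟨a, rfl⟩ := hi
      simp [swap, hg.extend_apply]
    · simp [swap, Function.extend_apply' _ _ _ hi]
  have hpreimage : swap ⁻¹' (T ×ˢ Set.univ) = Set.univ ×ˢ {f | f ∘ g ∈ T} := by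
    ext ⟨h, f⟩
    simp [swap]
  rw [← Set.ncard_univ, ← Set.ncard_univ, mul_comm, ← Set.ncard_prod, ← Set.ncard_prod,
    ← hpreimage, ncard_preimage_of_involutive hswap]

variable {A : β → Set (Π i, V i)} {supp : β → Finset ι}

theorem dependsOn_avoid (hA : ∀ b, DependsOn (· ∈ A b) (supp b : Set ι)) {s : Set ι}
    {S : Finset β} (hS : ∀ b ∈ S, (supp b : Set ι) ⊆ s) : DependsOn (· ∈ avoid A S) s :=
  fun _ _ hfg => propext <| forall₂_congr fun b hb =>
    not_congr ((hA b).mono (hS b hb) hfg).to_iff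

variable [Finite ι] [∀ i, Finite (V i)] {p x : ℝ}

theorem ncard_inter_avoid_le (hA : ∀ b, DependsOn (· ∈ A b) (supp b : Set ι)) {b : β}
    (hp : ((A b).ncard : ℝ) ≤ p * Nat.card (Π i, V i)) {S : Finset β}
    (hS : ∀ c ∈ S, Disjoint (supp b) (supp c)) :
    ((A b ∩ avoid A S).ncard : ℝ) ≤ p * (avoid A S).ncard := by
  rcases isEmpty_or_nonempty (Π i, V i) with _ | _
  · simp [Set.eq_empty_of_isEmpty]
  have hindep := ncard_inter_mul_card_of_dependsOn (hA b) <| dependsOn_avoid hA (S := S)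
    fun c hc => Set.subset_compl_iff_disjoint_left.2 (disjoint_coe.2 (hS c hc))
  have hcard : (0 : ℝ) < Nat.card (Π i, V i) := Nat.cast_pos.2 Nat.card_pos
  refine le_of_mul_le_mul_right ?_ hcard
  calc ((A b ∩ avoid A S).ncard : ℝ) * Nat.card (Π i, V i)
      = (A b).ncard * (avoid A S).ncard := mod_cast hindep
    _ ≤ p * Nat.card (Π i, V i) * (avoid A S).ncard := by gcongr
    _ = p * (avoid A S).ncard * Nat.card (Π i, V i) := by ring

theorem measureReal_count_eq_ncard {Ω : Type*} [Finite Ω] [MeasurableSpace Ω]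
    [MeasurableSingletonClass Ω] (s : Set Ω) : Measure.count.real s = s.ncard := by
  rw [measureReal_def, Measure.count_apply s.toFinite.measurableSet, ← s.toFinite.cast_ncard_eq,
    ENat.toENNReal_coe, ENNReal.toReal_natCast]

theorem one_sub_pow_mul_card_le_ncard_avoid
    (hA : ∀ b, DependsOn (· ∈ A b) (supp b : Set ι))
    (hp : ∀ b, ((A b).ncard : ℝ) ≤ p * Nat.card (Π i, V i)) {Γ : β → Finset β} {d : ℕ}
    (hΓ : ∀ b c, c ≠ b → ¬ Disjoint (supp b) (supp c) → c ∈ Γ b) (hd : ∀ b, #(Γ b) ≤ d)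
    (hx0 : 0 ≤ x) (hx1 : x ≤ 1) (hpx : p ≤ x * (1 - x) ^ d) (S : Finset β) :
    (1 - x) ^ #S * Nat.card (Π i, V i) ≤ (avoid A S).ncard := by
  let _ : MeasurableSpace (Π i, V i) := ⊤
  have h := prod_one_sub_mul_le_measureReal_avoid (A := A) (Γ := Γ) (x := fun _ => x)
    Measure.count (fun _ => hx0) (fun _ => hx1) (fun b S hbS hS => ?_) S
  · simpa only [prod_const, measureReal_count_eq_ncard, Set.ncard_univ] using h
  have hdisj : ∀ c ∈ S, Disjoint (supp b) (supp c) := fun c hc => by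
    by_contra hbc
    exact disjoint_left.1 hS hc (hΓ b c (ne_of_mem_of_not_mem hc hbS) hbc)
  simp only [prod_const, measureReal_count_eq_ncard]
  refine (ncard_inter_avoid_le hA (hp b) hdisj).trans ?_
  gcongr
  refine hpx.trans (mul_le_mul_of_nonneg_left ?_ hx0)
  exact pow_le_pow_of_le_one (sub_nonneg.2 hx1) (sub_le_self 1 hx0) (hd b)

theorem one_sub_mul_pow_mul_card_le_ncard_avoid [Fintype ι] [DecidableEq ι] [Fintype β]
    (hA : ∀ b, DependsOn (· ∈ A b) (supp b : Set ι))
    (hp : ∀ b, ((A b).ncard : ℝ) ≤ p * Nat.card (Π i, V i)) {k q : ℕ}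
    (hk : ∀ b, #(supp b) = k + 1) (hq : ∀ v, #{b | v ∈ supp b} ≤ q)
    (hx0 : 0 ≤ x) (hx1 : q * x ≤ 1) (hpx : p ≤ x * (1 - (q - 1) * x) ^ k) :
    (1 - q * x) ^ Fintype.card ι * Nat.card (Π i, V i) ≤ (avoid A univ).ncard := by
  classical
  let _ : MeasurableSpace (Π i, V i) := ⊤
  have hclique : ∀ v, ∑ b with v ∈ supp b, x ≤ q * x := fun v => by
    rw [sum_const, nsmul_eq_mul]
    gcongr
    exact hq v
  have hothers : ∀ b, ∀ u ∈ supp b, ∑ c with u ∈ supp c ∧ c ≠ b, x ≤ (q - 1) * x := by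
    intro b u hu
    have hb : b ∈ ({c | u ∈ supp c} : Finset β) := by simpa using hu
    have h := hclique u
    rw [← sum_erase_add _ _ hb] at h
    rw [erase_eq, ← filter_notMem_eq_sdiff, filter_filter] at h
    simp only [mem_singleton] at h
    linarith
  have h := prod_one_sub_sum_mul_le_measureReal_avoid (A := A) (supp := supp) (x := fun _ _ => x)
    Measure.count (fun b => card_pos.1 (by rw [hk b]; omega)) (fun _ _ => hx0)
    (fun v => (hclique v).trans hx1) fun b v hv S hS => ?_
  · simp only [measureReal_count_eq_ncard, Set.ncard_univ] at h
    refine le_trans (mul_le_mul_of_nonneg_right ?_ (Nat.cast_nonneg _)) h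
    rw [← card_univ, ← prod_const]
    exact prod_le_prod (fun _ _ => sub_nonneg.2 hx1) fun v _ => sub_le_sub_left (hclique v) 1
  · simp only [measureReal_count_eq_ncard]
    refine (ncard_inter_avoid_le hA (hp b) hS).trans ?_
    gcongr
    refine hpx.trans (mul_le_mul_of_nonneg_left ?_ hx0)
    have hkv : k = #((supp b).erase v) := by rw [card_erase_of_mem hv, hk b, Nat.add_sub_cancel]
    rw [hkv, ← prod_const]
    refine prod_le_prod (fun _ _ => ?_)
      fun u hu => sub_le_sub_left (hothers b u (mem_of_mem_erase hu)) 1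
    linarith [sub_one_mul (q : ℝ) x]

end Product

end LocalLemma

namespace QCSC

open Finset LocalLemma

section Energy

open scoped Combinatorics.Additive Pointwise

theorem card_filter_range_product_add_eq (n k : ℕ) :
    #{x ∈ range n ×ˢ range n | x.1 + x.2 = k} = min n (k + 1) - (k + 1 - n) := by
  rw [← Nat.card_Ico]
  refine card_nbij' (fun x => x.1) (fun i => (i, k - i)) ?_ ?_ ?_ ?_ <;>
    simp only [Set.MapsTo, Set.LeftInvOn, Set.RightInvOn, coe_filter, coe_Ico, mem_product,
      mem_range, Set.mem_ofPred_eq, Set.mem_Ico, Prod.forall, Prod.mk.injEq, true_and] <;> grind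

theorem six_mul_sum_range_sq (n : ℕ) : 6 * ∑ k ∈ range n, k ^ 2 + 3 * n ^ 2 = 2 * n ^ 3 + n := by
  induction n with
  | zero => rfl
  | succ n ih => rw [sum_range_succ]; linarith

theorem addEnergy_range (n : ℕ) :
    E[range n] = ∑ k ∈ range n, (k + 1) ^ 2 + ∑ k ∈ range n, k ^ 2 := by
  have hsupport : range n + range n ⊆ range (n + n) := fun k hk => by
    obtain ⟨a, ha, b, hb, rfl⟩ := mem_add.1 hk
    exact mem_range.2 (add_lt_add (mem_range.1 ha) (mem_range.1 hb))
  rw [addEnergy_eq_sum_sq', sum_subset hsupport, sum_range_add, ← sum_range_reflect (· ^ 2)]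
  · simp only [card_filter_range_product_add_eq]
    congr 1 <;> refine sum_congr rfl fun k hk => ?_ <;> rw [mem_range] at hk <;> congr 1 <;> omega
  · intro k _ hk
    rw [filter_false_of_mem fun x hx h => hk ?_, card_empty, zero_pow two_ne_zero]
    obtain ⟨h1, h2⟩ := mem_product.1 hx
    exact h ▸ add_mem_add h1 h2

theorem three_mul_addEnergy_range (n : ℕ) : 3 * E[range n] = n * (2 * n ^ 2 + 1) := by
  have hshift := sum_range_succ' (· ^ 2) n
  rw [sum_range_succ, zero_pow two_ne_zero, add_zero] at hshift
  have hsq := six_mul_sum_range_sq n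
  rw [addEnergy_range, ← hshift]
  linarith

end Energy

section Pairs

variable {α : Type*} [Fintype α]

theorem card_subtype_powersetCard (k : ℕ) :
    Fintype.card (Set.powersetCard α k) = (Fintype.card α).choose k := by
  rw [← Nat.card_eq_fintype_card, Set.powersetCard.card, Nat.card_eq_fintype_card]

variable [DecidableEq α]

theorem card_powersetCard_disjoint (k : ℕ) (u : Finset α) :
    #{s : Set.powersetCard α k | Disjoint u s.1} = (Fintype.card α - #u).choose k := by
  rw [← card_compl, ← card_powersetCard]
  refine card_bij (fun s _ => s.1) (fun s hs => ?_) (fun _ _ _ _ h => Subtype.ext h)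
    fun s hs => ?_
  · exact mem_powersetCard.2 ⟨subset_compl_iff_disjoint_left.2 (mem_filter.1 hs).2, s.2⟩
  · obtain ⟨hsu, hcard⟩ := mem_powersetCard.1 hs
    exact ⟨⟨s, hcard⟩, by simpa using subset_compl_iff_disjoint_left.1 hsu, rfl⟩

theorem card_powersetCard_not_disjoint (k : ℕ) (u : Finset α) :
    #{s : Set.powersetCard α k | ¬ Disjoint u s.1} =
      (Fintype.card α).choose k - (Fintype.card α - #u).choose k := by
  rw [← card_subtype_powersetCard, ← card_powersetCard_disjoint, filter_not,
    card_sdiff_of_subset (filter_subset _ _), card_univ]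

theorem choose_two_sub_choose_two_sub_one (n : ℕ) : n.choose 2 - (n - 1).choose 2 = n - 1 := by
  cases n with
  | zero => rfl
  | succ n => simp [Nat.choose_succ_succ' n 1]

theorem card_pair_mem (a : α) :
    #{s : Set.powersetCard α 2 | a ∈ s.1} = Fintype.card α - 1 := by
  have h := card_powersetCard_not_disjoint 2 {a}
  simpa only [disjoint_singleton_left, not_not, card_singleton,
    choose_two_sub_choose_two_sub_one] using h

theorem card_pair_not_disjoint (s : Set.powersetCard α 2) :
    #{t : Set.powersetCard α 2 | ¬ Disjoint s.1 t.1} = 2 * Fintype.card α - 3 := by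
  rw [card_powersetCard_not_disjoint, s.2]
  have hn : 2 ≤ Fintype.card α := s.2 ▸ card_le_univ s.1
  obtain ⟨n, hn⟩ := Nat.exists_eq_add_of_le' hn
  rw [hn, Nat.add_sub_cancel]
  have h₁ : (n + 2).choose 2 = n + 1 + (n + 1).choose 2 := by simp [Nat.choose_succ_succ' _ 1]
  have h₂ : (n + 1).choose 2 = n + n.choose 2 := by simp [Nat.choose_succ_succ' _ 1]
  omega

end Pairs

section Balance

open scoped Combinatorics.Additive

variable {m Z : ℕ}

/-- The balance equations on the labels `a, b, c, d` of the base edges `(i₁, j₁)`, `(i₁, j₂)`,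
`(i₂, j₁)`, `(i₂, j₂)`, which every active 4-cycle candidate satisfies. The shifts are compared as
natural numbers in the partition matrix and modulo `Z` in the lifting matrix. -/
def IsBalanced (a b c d : Fin (m + 1) × ZMod Z) : Prop :=
  (a.1 : ℕ) + d.1 = b.1 + c.1 ∧ a.2 + d.2 = b.2 + c.2

theorem IsBalanced.swap_rows {a b c d : Fin (m + 1) × ZMod Z} (h : IsBalanced a b c d) :
    IsBalanced c d a b :=
  ⟨by have := h.1; omega, by rw [add_comm, ← h.2, add_comm]⟩

theorem IsBalanced.swap_cols {a b c d : Fin (m + 1) × ZMod Z} (h : IsBalanced a b c d) :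
    IsBalanced b a d c :=
  ⟨h.1.symm, h.2.symm⟩

theorem ncard_isBalanced_le (m Z : ℕ) [NeZero Z] :
    {h : Fin 4 → Fin (m + 1) × ZMod Z | IsBalanced (h 0) (h 1) (h 2) (h 3)}.ncard ≤
      E[range (m + 1)] * E[(univ : Finset (ZMod Z))] := by
  let quadruple (h : Fin 4 → Fin (m + 1) × ZMod Z) :
      ((ℕ × ℕ) × ℕ × ℕ) × (ZMod Z × ZMod Z) × ZMod Z × ZMod Z :=
    ((((h 0).1, (h 1).1), ((h 3).1, (h 2).1)), (((h 0).2, (h 1).2), ((h 3).2, (h 2).2)))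
  rw [addEnergy, addEnergy, ← card_product, ← Set.ncard_coe_finset]
  refine Set.ncard_le_ncard_of_injOn quadruple (fun h hh => ?_) fun h _ h' _ heq => ?_
  · simpa [quadruple, IsBalanced, Fin.is_le] using hh
  · simp only [quadruple, Prod.mk.injEq, Fin.val_inj] at heq
    ext i <;> fin_cases i <;> simp [heq]

theorem three_mul_ncard_isBalanced_le (m Z : ℕ) [NeZero Z] :
    3 * {h : Fin 4 → Fin (m + 1) × ZMod Z | IsBalanced (h 0) (h 1) (h 2) (h 3)}.ncard ≤
      (m + 1) * (2 * (m + 1) ^ 2 + 1) * Z ^ 3 :=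
  calc _ ≤ 3 * (E[range (m + 1)] * E[(univ : Finset (ZMod Z))]) :=
        Nat.mul_le_mul_left 3 (ncard_isBalanced_le m Z)
    _ = _ := by
      rw [← mul_assoc, three_mul_addEnergy_range, addEnergy_univ_left, card_univ, ZMod.card,
        ← pow_succ']

/-- The probability `(2m² + 4m + 3) / (3(m + 1)³Z)` that four independent uniform labels are
balanced: it is `E[{0, …, m}] / (m + 1)⁴ * E[ℤ/Z] / Z⁴` for the additive energies `E`. -/
noncomputable def balanceProb (m Z : ℕ) : ℝ :=
  (2 * (m : ℝ) ^ 2 + 4 * m + 3) / (3 * ((m : ℝ) + 1) ^ 3 * Z)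

theorem ncard_isBalanced_le_balanceProb_mul (m Z : ℕ) [NeZero Z] :
    ({h : Fin 4 → Fin (m + 1) × ZMod Z | IsBalanced (h 0) (h 1) (h 2) (h 3)}.ncard : ℝ) ≤
      balanceProb m Z * Nat.card (Fin 4 → Fin (m + 1) × ZMod Z) := by
  have hcount : 3 * ({h : Fin 4 → Fin (m + 1) × ZMod Z |
      IsBalanced (h 0) (h 1) (h 2) (h 3)}.ncard : ℝ) ≤
        (m + 1) * (2 * (m + 1) ^ 2 + 1) * Z ^ 3 := mod_cast three_mul_ncard_isBalanced_le m Z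
  have hcard : (Nat.card (Fin 4 → Fin (m + 1) × ZMod Z) : ℝ) = ((m + 1) * Z) ^ 4 := by simp
  have hZ : (Z : ℝ) ≠ 0 := Nat.cast_ne_zero.2 (NeZero.ne Z)
  have heval : balanceProb m Z * ((m + 1) * Z) ^ 4 =
      (m + 1) * (2 * (m + 1) ^ 2 + 1) * Z ^ 3 / 3 := by
    rw [balanceProb]
    field_simp
    ring
  rw [hcard, heval]
  linarith

end Balance

section Activity

theorem circulant_pow_apply (Z : ℕ) [NeZero Z] (k : ℕ) (a b : ZMod Z) :
    (circulant Z ^ k) a b = if b = a - k then 1 else 0 := by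
  induction k generalizing b with
  | zero => simp [Matrix.one_apply, eq_comm]
  | succ k ih =>
    rw [pow_succ, Matrix.mul_apply]
    simp only [ih, circulant, ite_mul, one_mul, zero_mul, sum_ite_eq', mem_univ, if_true,
      Nat.cast_succ, sub_sub]

variable {γ κ m Z N : ℕ} [NeZero Z] {D : Design γ κ m Z}

theorem Design.labels_of_parityCheck_eq_one {r : (Fin (N + m) × Fin γ) × ZMod Z}
    {c : (Fin N × Fin κ) × ZMod Z} (h : D.parityCheck N r c = 1) :
    (c.1.1 : ℕ) + (D r.1.2 c.1.2).1 = r.1.1 ∧ c.2 + (D r.1.2 c.1.2).2 = r.2 := by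
  have hcoupled : D.coupled N r.1 c.1 ≠ 0 := left_ne_zero_of_mul_eq_one h
  have hlifted := right_ne_zero_of_mul_eq_one h
  rw [circulant_pow_apply, ZMod.natCast_zmod_val, ite_ne_right_iff] at hlifted
  rw [coupled, ite_ne_right_iff, component, ite_ne_right_iff] at hcoupled
  exact ⟨by have := hcoupled.2.1; unfold partition at this; omega, eq_sub_iff_add_eq.1 hlifted.1⟩

theorem FourCycle.IsActive.isBalanced {c : FourCycle γ κ} (h : c.IsActive D N) :
    IsBalanced (D c.i₁ c.j₁) (D c.i₁ c.j₂) (D c.i₂ c.j₁) (D c.i₂ c.j₂) := by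
  obtain ⟨r₁, r₂, c₁, c₂, hr₁, hr₂, hc₁, hc₂, h₁₁, h₁₂, h₂₂, h₂₁⟩ := h
  rw [← hr₁, ← hr₂, ← hc₁, ← hc₂]
  obtain ⟨hP₁₁, hL₁₁⟩ := Design.labels_of_parityCheck_eq_one h₁₁
  obtain ⟨hP₁₂, hL₁₂⟩ := Design.labels_of_parityCheck_eq_one h₁₂
  obtain ⟨hP₂₂, hL₂₂⟩ := Design.labels_of_parityCheck_eq_one h₂₂
  obtain ⟨hP₂₁, hL₂₁⟩ := Design.labels_of_parityCheck_eq_one h₂₁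
  exact ⟨by omega, by linear_combination hL₁₁ - hL₁₂ + hL₂₂ - hL₂₁⟩

end Activity

section Rectangles

variable {γ κ m Z : ℕ}

/-- The 4-cycle candidates up to the order of their two rows and of their two columns. They index
the bad events of the local lemmas. -/
abbrev Rectangle (γ κ : ℕ) : Type := Set.powersetCard (Fin γ) 2 × Set.powersetCard (Fin κ) 2

/-- The set of the four base edges of a rectangle. -/
def Rectangle.edges (b : Rectangle γ κ) : Finset (Fin γ × Fin κ) := b.1.1 ×ˢ b.2.1

/-- The rectangle spanned by a 4-cycle candidate. -/
def FourCycle.rectangle (c : FourCycle γ κ) : Rectangle γ κ :=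
  (⟨{c.i₁, c.i₂}, card_pair c.rows_ne⟩, ⟨{c.j₁, c.j₂}, card_pair c.cols_ne⟩)

/-- The four base edges of a 4-cycle candidate, in the order in which `IsBalanced` takes them. -/
def FourCycle.edge (c : FourCycle γ κ) : Fin 4 → Fin γ × Fin κ :=
  ![(c.i₁, c.j₁), (c.i₁, c.j₂), (c.i₂, c.j₁), (c.i₂, c.j₂)]

theorem FourCycle.edge_injective (c : FourCycle γ κ) : c.edge.Injective := by
  intro x y hxy
  have hi := c.rows_ne
  have hj := c.cols_ne
  fin_cases x <;> fin_cases y <;> simp_all [edge, eq_comm]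

theorem FourCycle.edge_mem_edges (c : FourCycle γ κ) (k : Fin 4) :
    c.edge k ∈ c.rectangle.edges := by
  fin_cases k <;> simp [edge, Rectangle.edges, rectangle]

theorem FourCycle.rectangle_surjective :
    (rectangle : FourCycle γ κ → Rectangle γ κ).Surjective := by
  rintro ⟨⟨s, hs⟩, ⟨t, ht⟩⟩
  obtain ⟨i₁, i₂, hi, rfl⟩ := card_eq_two.1 hs
  obtain ⟨j₁, j₂, hj, rfl⟩ := card_eq_two.1 ht
  exact ⟨⟨j₁, i₁, j₂, i₂, hi, hj⟩, rfl⟩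

/-- The event that some 4-cycle candidate spanning the rectangle `b` is balanced. Labelings are
uncurried designs. -/
def balancedEvent (b : Rectangle γ κ) : Set (Fin γ × Fin κ → Fin (m + 1) × ZMod Z) :=
  {f | ∃ c : FourCycle γ κ, c.rectangle = b ∧
    IsBalanced (f (c.edge 0)) (f (c.edge 1)) (f (c.edge 2)) (f (c.edge 3))}

theorem mem_balancedEvent_rectangle (c : FourCycle γ κ)
    {f : Fin γ × Fin κ → Fin (m + 1) × ZMod Z} :
    f ∈ balancedEvent c.rectangle ↔
      IsBalanced (f (c.edge 0)) (f (c.edge 1)) (f (c.edge 2)) (f (c.edge 3)) := by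
  refine ⟨?_, fun h => ⟨c, rfl, h⟩⟩
  rintro ⟨⟨j₁, i₁, j₂, i₂, _, _⟩, heq, h⟩
  obtain ⟨j₁', i₁', j₂', i₂', _, _⟩ := c
  simp only [FourCycle.rectangle, Prod.mk.injEq, Subtype.ext_iff, ← coe_inj, coe_pair,
    Set.pair_eq_pair_iff] at heq
  rcases heq with ⟨⟨rfl, rfl⟩ | ⟨rfl, rfl⟩, ⟨rfl, rfl⟩ | ⟨rfl, rfl⟩⟩
  exacts [h, h.swap_cols, h.swap_rows, h.swap_rows.swap_cols]

theorem dependsOn_balancedEvent (b : Rectangle γ κ) :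
    DependsOn (· ∈ balancedEvent (m := m) (Z := Z) b) (b.edges : Set (Fin γ × Fin κ)) := by
  obtain ⟨c, rfl⟩ := FourCycle.rectangle_surjective b
  intro f g hfg
  simp only [mem_balancedEvent_rectangle, hfg _ (c.edge_mem_edges _)]

theorem ncard_balancedEvent_le [NeZero Z] (b : Rectangle γ κ) :
    ((balancedEvent (m := m) (Z := Z) b).ncard : ℝ) ≤
      balanceProb m Z * Nat.card (Fin γ × Fin κ → Fin (m + 1) × ZMod Z) := by
  obtain ⟨c, rfl⟩ := FourCycle.rectangle_surjective b
  have hmarginal := ncard_comp_mem_mul_card c.edge_injective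
    {h : Fin 4 → Fin (m + 1) × ZMod Z | IsBalanced (h 0) (h 1) (h 2) (h 3)}
  have hevent : balancedEvent c.rectangle = {f : Fin γ × Fin κ → Fin (m + 1) × ZMod Z |
      f ∘ c.edge ∈ {h | IsBalanced (h 0) (h 1) (h 2) (h 3)}} :=
    Set.ext fun f => mem_balancedEvent_rectangle c
  rw [hevent]
  have hcard : (0 : ℝ) < Nat.card (Fin 4 → Fin (m + 1) × ZMod Z) := Nat.cast_pos.2 Nat.card_pos
  refine le_of_mul_le_mul_right ?_ hcard
  rw [mul_right_comm]
  calc _ = _ := mod_cast hmarginal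
    _ ≤ _ := mul_le_mul_of_nonneg_right (ncard_isBalanced_le_balanceProb_mul m Z)
      (Nat.cast_nonneg _)

theorem Rectangle.card_edges (b : Rectangle γ κ) : #b.edges = 3 + 1 := by
  rw [Rectangle.edges, card_product, b.1.2, b.2.2]

theorem card_rectangle : Fintype.card (Rectangle γ κ) = γ.choose 2 * κ.choose 2 := by
  rw [Fintype.card_prod, card_subtype_powersetCard, card_subtype_powersetCard, Fintype.card_fin,
    Fintype.card_fin]

theorem card_rectangle_mem_edges (e : Fin γ × Fin κ) :
    #{b : Rectangle γ κ | e ∈ b.edges} = (γ - 1) * (κ - 1) := by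
  simp only [Rectangle.edges, mem_product]
  rw [← univ_product_univ, filter_product (fun s : Set.powersetCard (Fin γ) 2 => e.1 ∈ s.1)
    (fun t : Set.powersetCard (Fin κ) 2 => e.2 ∈ t.1), card_product, card_pair_mem, card_pair_mem,
    Fintype.card_fin, Fintype.card_fin]

theorem card_rectangle_not_disjoint (b : Rectangle γ κ) :
    #{c : Rectangle γ κ | ¬ Disjoint b.edges c.edges} = Delta γ κ := by
  simp only [Rectangle.edges, disjoint_product, not_or]
  rw [← univ_product_univ,
    filter_product (fun s : Set.powersetCard (Fin γ) 2 => ¬ Disjoint b.1.1 s.1)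
      (fun t : Set.powersetCard (Fin κ) 2 => ¬ Disjoint b.2.1 t.1),
    card_product, card_pair_not_disjoint, card_pair_not_disjoint, Fintype.card_fin,
    Fintype.card_fin, Delta]

theorem card_erase_rectangle_not_disjoint (b : Rectangle γ κ) :
    #(({c | ¬ Disjoint b.edges c.edges} : Finset (Rectangle γ κ)).erase b) = Delta γ κ - 1 := by
  have hb : b.edges.Nonempty := card_pos.1 (by rw [Rectangle.card_edges]; omega)
  rw [card_erase_of_mem (by simpa using hb.ne_empty), card_rectangle_not_disjoint]

end Rectangles

section Designs

variable {γ κ m Z : ℕ} [NeZero Z]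

theorem ncard_avoid_balancedEvent_le (N : ℕ) :
    (avoid (balancedEvent (m := m) (Z := Z)) (univ : Finset (Rectangle γ κ))).ncard ≤
      Nat.card (fourCycleFree γ κ m Z N) := by
  rw [Nat.card_coe_set_eq]
  refine Set.ncard_le_ncard_of_injOn Function.curry (fun f hf c hc => ?_)
    Function.curry_injective.injOn
  exact hf c.rectangle (mem_univ _) ((mem_balancedEvent_rectangle c).2 hc.isBalanced)

theorem card_fourCycleFree_le (N : ℕ) :
    Nat.card (fourCycleFree γ κ m Z N) ≤ γ ! * κ ! * numNonequivalent γ κ m Z N := by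
  set s := (matrixEquiv γ κ (Fin (m + 1) × ZMod Z)).comap
    (Subtype.val : fourCycleFree γ κ m Z N → Design γ κ m Z)
  have hrep : ∀ D : fourCycleFree γ κ m Z N, ∃ z : Equiv.Perm (Fin γ) × Equiv.Perm (Fin κ),
      ∀ i j, D.1 i j = (Quotient.out (Quotient.mk s D)).1 (z.1 i) (z.2 j) := by
    intro D
    obtain ⟨ν, ρ, h⟩ := Setoid.symm' s (Quotient.mk_out (s := s) D)
    exact ⟨(ν, ρ), h⟩
  choose z hz using hrep
  have hinj : Function.Injective fun D : fourCycleFree γ κ m Z N => (z D, Quotient.mk s D) := by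
    intro D D' h
    obtain ⟨hperm, hclass⟩ := Prod.mk.inj h
    refine Subtype.ext (Matrix.ext fun i j => ?_)
    rw [hz D, hz D', hperm, hclass]
  have h := Nat.card_le_card_of_injective _ hinj
  rwa [Nat.card_prod, Nat.card_prod, Nat.card_perm, Nat.card_perm, Nat.card_fin,
    Nat.card_fin] at h

theorem div_factorial_le_numNonequivalent {w : ℝ}
    (hw : w * Nat.card (Fin γ × Fin κ → Fin (m + 1) × ZMod Z) ≤
      (avoid (balancedEvent (m := m) (Z := Z)) (univ : Finset (Rectangle γ κ))).ncard) (N : ℕ) :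
    ((Z : ℝ) * (m + 1)) ^ (γ * κ) * w / ((γ ! : ℝ) * (κ ! : ℝ)) ≤
      numNonequivalent γ κ m Z N := by
  have hcard : (Nat.card (Fin γ × Fin κ → Fin (m + 1) × ZMod Z) : ℝ) =
      ((Z : ℝ) * (m + 1)) ^ (γ * κ) := by simp [mul_comm]
  have hclasses : (avoid (balancedEvent (m := m) (Z := Z))
      (univ : Finset (Rectangle γ κ))).ncard ≤ γ ! * κ ! * numNonequivalent γ κ m Z N :=
    (ncard_avoid_balancedEvent_le N).trans (card_fourCycleFree_le N)
  rw [div_le_iff₀' (by positivity), ← hcard, mul_comm]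
  exact hw.trans (mod_cast hclasses)

theorem le_numNonequivalent_of_le_boundI (hγ : 2 ≤ γ) (hκ : 2 ≤ κ)
    (h : balanceProb m Z ≤ boundI γ κ) (N : ℕ) :
    ((Z : ℝ) * (m + 1)) ^ (γ * κ) *
        (1 - 1 / (Delta γ κ : ℝ)) ^ (γ.choose 2 * κ.choose 2) / ((γ ! : ℝ) * (κ ! : ℝ)) ≤
      numNonequivalent γ κ m Z N := by
  have hΔ : 0 < Delta γ κ := Nat.mul_pos (by omega) (by omega)
  have hΔ1 : (1 : ℝ) ≤ Delta γ κ := mod_cast hΔ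
  have hI : boundI γ κ =
      1 / (Delta γ κ : ℝ) * (1 - 1 / (Delta γ κ : ℝ)) ^ (Delta γ κ - 1) := by
    rw [boundI, one_sub_div (by positivity), div_pow, div_mul_div_comm, one_mul, ← pow_succ',
      Nat.sub_add_cancel hΔ]
  rw [← card_rectangle, ← card_univ]
  refine div_factorial_le_numNonequivalent ?_ N
  exact one_sub_pow_mul_card_le_ncard_avoid dependsOn_balancedEvent ncard_balancedEvent_le
    (fun b c hcb hbc => mem_erase.2 ⟨hcb, by simpa using hbc⟩)
    (fun b => (card_erase_rectangle_not_disjoint b).le) (by positivity)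
    (div_le_one_of_le₀ hΔ1 (by positivity)) (h.trans_eq hI) univ

theorem le_numNonequivalent_of_le_boundII (hγκ : γ + κ < γ * κ)
    (h : balanceProb m Z ≤ boundII γ κ) (N : ℕ) :
    ((Z : ℝ) * (m + 1)) ^ (γ * κ) *
        (1 - ((γ : ℝ) * κ - γ - κ + 1) / (4 * ((γ : ℝ) * κ - γ - κ))) ^ (γ * κ) /
          ((γ ! : ℝ) * (κ ! : ℝ)) ≤
      numNonequivalent γ κ m Z N := by
  set d : ℝ := (γ : ℝ) * κ - γ - κ with hd
  have hd1 : 1 ≤ d := by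
    have : (γ : ℝ) + κ + 1 ≤ γ * κ := mod_cast hγκ
    linarith
  have hq : (((γ - 1) * (κ - 1) : ℕ) : ℝ) = d + 1 := by
    have hγ : 0 < γ := Nat.pos_of_ne_zero (by rintro rfl; omega)
    have hκ : 0 < κ := Nat.pos_of_ne_zero (by rintro rfl; omega)
    rw [Nat.cast_mul, Nat.cast_pred hγ, Nat.cast_pred hκ]
    ring
  have hII : boundII γ κ = 1 / (4 * d) * (1 - (d + 1 - 1) * (1 / (4 * d))) ^ 3 := by
    rw [boundII, ← hd]
    field_simp
    ring
  have hclique := one_sub_mul_pow_mul_card_le_ncard_avoid (x := 1 / (4 * d))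
    dependsOn_balancedEvent ncard_balancedEvent_le Rectangle.card_edges
    (fun e => (card_rectangle_mem_edges e).le) (by positivity) ?_ (hq ▸ h.trans_eq hII)
  · rw [hq, mul_one_div, Fintype.card_prod, Fintype.card_fin, Fintype.card_fin] at hclique
    exact div_factorial_le_numNonequivalent hclique N
  · rw [hq, mul_one_div, div_le_one₀ (by positivity)]
    linarith

theorem three_le_Delta (hγ : 2 ≤ γ) (hκ : 2 ≤ κ) (hγκ : γ + κ < γ * κ) : 3 ≤ Delta γ κ := by
  unfold Delta
  rcases hγ.eq_or_lt with rfl | hγ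
  · omega
  · exact Nat.mul_le_mul (show 3 ≤ 2 * γ - 3 by omega) (show 1 ≤ 2 * κ - 3 by omega)

end Designs

end QCSC

open QCSC in
theorem corollary2_general (γ κ m Z N : ℕ) [NeZero Z] (hγ : 2 ≤ γ) (hκ : 2 ≤ κ)
    (hγκ : γ + κ < γ * κ) :
    (balanceProb m Z ≤ boundI γ κ →
      ((Z : ℝ) * (m + 1)) ^ (γ * κ) *
          (1 - 1 / (Delta γ κ : ℝ)) ^ (γ.choose 2 * κ.choose 2) / ((γ ! : ℝ) * (κ ! : ℝ)) ≤
        (numNonequivalent γ κ m Z N : ℝ)) ∧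
    (balanceProb m Z ≤ boundII γ κ →
      ((Z : ℝ) * (m + 1)) ^ (γ * κ) *
          (1 - ((γ : ℝ) * κ - γ - κ + 1) / (4 * ((γ : ℝ) * κ - γ - κ))) ^ (γ * κ) /
            ((γ ! : ℝ) * (κ ! : ℝ)) ≤
        (numNonequivalent γ κ m Z N : ℝ)) :=
  ⟨fun h => le_numNonequivalent_of_le_boundI hγ hκ h N,
    fun h => le_numNonequivalent_of_le_boundII hγκ h N⟩

open QCSC in
theorem corollary2 (γ κ m Z N : ℕ) [NeZero Z] (hγ : 2 ≤ γ) (hκ : 2 ≤ κ) (hγκ : γ + κ < γ * κ)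
    (hN : 1 ≤ N)
    (hcond : (2 * (m : ℝ) ^ 2 + 4 * m + 3) / (3 * ((m : ℝ) + 1) ^ 3 * Z) ≤
      max (QCSC.boundI γ κ) (QCSC.boundII γ κ)) :
    (QCSC.boundI γ κ > QCSC.boundII γ κ →
      ((Z : ℝ) * (m + 1)) ^ (γ * κ) *
          (1 - 2 / (QCSC.Delta γ κ : ℝ)) ^ (γ.choose 2 * κ.choose 2) / ((γ ! : ℝ) * (κ ! : ℝ)) ≤
        (QCSC.numNonequivalent γ κ m Z N : ℝ)) ∧
    (QCSC.boundI γ κ ≤ QCSC.boundII γ κ →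
      ((Z : ℝ) * (m + 1)) ^ (γ * κ) *
          (1 - ((γ : ℝ) * κ - γ - κ + 1) / (4 * ((γ : ℝ) * κ - γ - κ))) ^ (γ * κ) /
            ((γ ! : ℝ) * (κ ! : ℝ)) ≤
        (QCSC.numNonequivalent γ κ m Z N : ℝ)) := by
  have hgeneral := corollary2_general γ κ m Z N hγ hκ hγκ
  refine ⟨fun hI => ?_, fun hII => hgeneral.2 (hcond.trans_eq (max_eq_right hII))⟩
  have hΔ : (3 : ℝ) ≤ Delta γ κ := mod_cast three_le_Delta hγ hκ hγκ
  have hbase : 0 ≤ 1 - 2 / (Delta γ κ : ℝ) := by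
    rw [sub_nonneg, div_le_one] <;> linarith
  refine le_trans ?_ (hgeneral.1 (hcond.trans_eq (max_eq_left hI.le)))
  gcongr
  norm_num
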